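/- Let $G$ be a finite simple connected graph on at least three vertices. Write $N(v)$ for the set of neighbours of a vertex $v$, $d(v)=|N(v)|$ for its degree, and $d(u,v)$ for the distance between vertices $u$ and $v$ in $G$. Suppose that $G$ is an $L_1$-graph, that is, $$d(u)+d(v)\ge |N(u)\cup N(v)\cup N(w)|-1$$ for every triple of vertices $u,v,w$ with $d(u,v)=2$ and $w\in N(u)\cap N(v)$, and suppose that $|N(u)\cap N(v)|\ge 2$ for every pair of vertices $u,v$ with $d(u,v)=2$. Then for every pair of vertices $x,y$ of $G$ with no neighbours in common and every integer $m$ with $d(x,y)+1\le m\le |V(G)|$, there is a path in $G$ from $x$ to $y$ with $m$ or $m-1$ vertices. -/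

import Mathlib

namespace SimpleGraph

/-- `G` is an `L_i`-graph: `d(u) + d(v) ≥ |N(u) ∪ N(v) ∪ N(w)| - i` for every triple of vertices
`u, v, w` with `d(u, v) = 2` and `w ∈ N(u) ∩ N(v)`.  The term `i` is moved to the other side to
avoid truncated subtraction. -/
def IsLGraph {V : Type*} [DecidableEq V] (i : ℕ) (G : SimpleGraph V) [G.LocallyFinite] : Prop :=
  ∀ u v w : V, G.dist u v = 2 → w ∈ G.neighborFinset u ∩ G.neighborFinset v →
    (G.neighborFinset u ∪ G.neighborFinset v ∪ G.neighborFinset w).card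
      ≤ G.degree u + G.degree v + i

end SimpleGraph

/-! Induction on `m`, starting from a shortest path, reduces the theorem to `not_isGap`: a path with
`k` vertices, `k + 2 ≤ |V|`, yields one with `k + 1` or `k + 2` vertices.

Suppose it does not, and let `v` be off the path. As `x` and `y` have no common neighbour, `v`
misses an end, say `y`. If `v` is adjacent to `p i`, then `v` and `p (i + 1)` are at distance two
and their common neighbours lie on the path, while `v` and the successors `p (j + 1)` of neighbours
of `v` that are adjacent to `p i` are private neighbours of `p i`. The `L₁` condition thus compares
two counts for each `i`. Their sums over `i` agree, so equality holds throughout (`card_filter_eq`),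
which determines where the neighbours of `p i` can be (`eq_or_adj_of_adj`). Hence `v` is the top of
a comb: its neighbours are the teeth `p 0, p 2, …, p (2 * q - 2)`.

Vertices off the path are pairwise nonadjacent, have no common neighbour on the path, and each sees
`x` or `y`. Take `q` maximal over all paths with `k` vertices. Exchanging `v` with a vertex between
two teeth shows that such a vertex is adjacent to teeth only. Then `p (2 * q - 1)` is the only
common neighbour of `p (2 * q)` and some earlier tooth, against the hypothesis of two common
neighbours (`not_isComb`). -/

namespace SimpleGraph

/-- The vertices `p 0, …, p (k - 1)` form, in this order, a path of `G` from `x` to `y`. -/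
structure IsIndexedPath {V : Type*} (G : SimpleGraph V) (x y : V) (k : ℕ) (p : ℕ → V) : Prop where
  pos : 0 < k
  start : p 0 = x
  finish : p (k - 1) = y
  adj : ∀ i j, j < k → i + 1 = j → G.Adj (p i) (p j)
  inj : ∀ i j, i < k → j < k → p i = p j → i = j

/-- No path from `x` to `y` has `k + 1` or `k + 2` vertices. -/
structure IsGap {V : Type*} (G : SimpleGraph V) (x y : V) (k : ℕ) : Prop where
  one : ∀ p, ¬ G.IsIndexedPath x y (k + 1) p
  two : ∀ p, ¬ G.IsIndexedPath x y (k + 2) p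

/-- The vertex `v` is none of `p 0, …, p (k - 1)`. -/
def IsOff {V : Type*} (k : ℕ) (p : ℕ → V) (v : V) : Prop := ∀ i, i < k → p i ≠ v

/-! ### Path surgery: exchanges and insertions as index arithmetic. -/

section Surgery

variable {V : Type*} {G : SimpleGraph V} {x y : V} {k : ℕ} {p : ℕ → V}

theorem adj_congr {v : V} {i j : ℕ} (h : G.Adj v (p i)) (hij : i = j) : G.Adj v (p j) :=
  hij ▸ h

theorem adj_congr₂ {i j s t : ℕ} (h : G.Adj (p s) (p t)) (hs : s = i) (ht : t = j) :
    G.Adj (p i) (p j) := hs ▸ ht ▸ h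

namespace IsIndexedPath

theorem adj' (hp : G.IsIndexedPath x y k p) {i j : ℕ} (hi : i < k) (h : j + 1 = i) :
    G.Adj (p i) (p j) := (hp.adj j i hi h).symm

theorem reverse (hp : G.IsIndexedPath x y k p) :
    G.IsIndexedPath y x k (fun i => p (k - 1 - i)) where
  pos := hp.pos
  start := by simpa using hp.finish
  finish := by simpa using hp.start
  adj i j hj hij := hp.adj' (by omega) (by omega)
  inj i j hi hj h := by
    have := hp.inj _ _ (by omega) (by omega) h
    omega

/-- Insert `v` between `p i` and `p (i + 1)`. -/
theorem insert_one (hp : G.IsIndexedPath x y k p) {v : V} (hv : IsOff k p v) {i : ℕ}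
    (hik : i + 1 < k) (h₁ : G.Adj v (p i)) (h₂ : G.Adj v (p (i + 1))) :
    G.IsIndexedPath x y (k + 1)
      (fun t => if t ≤ i then p t else if t = i + 1 then v else p (t - 1)) := by
  have ha := hp.adj
  have hi := hp.inj
  refine ⟨by omega, ?_, ?_, ?_, ?_⟩
  · simpa using hp.start
  · rw [← hp.finish]; split_ifs <;> first | omega | exact congrArg p (by omega)
  · rintro s t ht rfl
    split_ifs <;> first
        | omega
        | exact ha _ _ (by omega) (by omega)
        | exact (ha _ _ (by omega) (by omega)).symm
        | exact adj_congr h₂ (by omega)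
        | exact (adj_congr h₁ (by omega)).symm
  · intro s t hs ht h
    split_ifs at h <;> first
        | omega
        | (have := hi _ _ (by omega) (by omega) h; omega)
        | exact (hv _ (by omega) h).elim
        | exact (hv _ (by omega) h.symm).elim

/-- Insert `v` and `u` between `p i` and `p (i + 1)`. -/
theorem insert_two (hp : G.IsIndexedPath x y k p) {u v : V} (hv : IsOff k p v)
    (hu : IsOff k p u) {i : ℕ} (huv : G.Adj v u)
    (hik : i + 1 < k) (h₁ : G.Adj v (p i)) (h₂ : G.Adj u (p (i + 1))) :
    G.IsIndexedPath x y (k + 2)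
      (fun t => if t ≤ i then p t else if t = i + 1 then v else if t = i + 2 then u
        else p (t - 2)) := by
  have ha := hp.adj
  have hi := hp.inj
  refine ⟨by omega, ?_, ?_, ?_, ?_⟩
  · simpa using hp.start
  · rw [← hp.finish]; split_ifs <;> first | omega | exact congrArg p (by omega)
  · rintro s t ht rfl
    split_ifs <;> first
        | omega
        | exact ha _ _ (by omega) (by omega)
        | exact (ha _ _ (by omega) (by omega)).symm
        | exact huv
        | exact adj_congr h₂ (by omega)
        | exact (adj_congr h₁ (by omega)).symm
  · intro s t hs ht h
    split_ifs at h <;> first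
        | omega
        | (have := hi _ _ (by omega) (by omega) h; omega)
        | exact (hv _ (by omega) h).elim
        | exact (hv _ (by omega) h.symm).elim
        | exact (hu _ (by omega) h).elim
        | exact (hu _ (by omega) h.symm).elim
        | exact (huv.ne h).elim
        | exact (huv.ne h.symm).elim

/-- Insert `v` and reverse the segment `p (i + 1), …, p j`. -/
theorem rotate (hp : G.IsIndexedPath x y k p) {v : V} (hv : IsOff k p v) {i j : ℕ}
    (hij : i < j) (hj : j + 1 < k) (h₁ : G.Adj v (p i)) (h₂ : G.Adj v (p j))
    (h₃ : G.Adj (p (i + 1)) (p (j + 1))) :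
    G.IsIndexedPath x y (k + 1)
      (fun t => if t ≤ i then p t else if t = i + 1 then v else if t ≤ j + 1 then p (i + j + 2 - t)
        else p (t - 1)) := by
  have ha := hp.adj
  have hi := hp.inj
  refine ⟨by omega, ?_, ?_, ?_, ?_⟩
  · simpa using hp.start
  · rw [← hp.finish]; split_ifs <;> first | omega | exact congrArg p (by omega)
  · rintro s t ht rfl
    split_ifs <;> first
        | omega
        | exact ha _ _ (by omega) (by omega)
        | exact (ha _ _ (by omega) (by omega)).symm
        | exact adj_congr h₂ (by omega)
        | exact (adj_congr h₁ (by omega)).symm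
        | exact adj_congr₂ h₃ (by omega) (by omega)
  · intro s t hs ht h
    split_ifs at h <;> first
        | omega
        | (have := hi _ _ (by omega) (by omega) h; omega)
        | exact (hv _ (by omega) h).elim
        | exact (hv _ (by omega) h.symm).elim

/-- Replace `p (i + 1)` by `v`. -/
theorem swap (hp : G.IsIndexedPath x y k p) {v : V} (hv : IsOff k p v) {i : ℕ}
    (hik : i + 2 < k) (h₁ : G.Adj v (p i)) (h₂ : G.Adj v (p (i + 2))) :
    G.IsIndexedPath x y k (fun t => if t = i + 1 then v else p t) := by
  have ha := hp.adj
  have hi := hp.inj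
  refine ⟨by omega, ?_, ?_, ?_, ?_⟩
  · simpa using hp.start
  · rw [← hp.finish]; split_ifs <;> first | omega | exact congrArg p (by omega)
  · rintro s t ht rfl
    split_ifs <;> first
        | omega
        | exact ha _ _ (by omega) (by omega)
        | exact (ha _ _ (by omega) (by omega)).symm
        | exact adj_congr h₂ (by omega)
        | exact (adj_congr h₁ (by omega)).symm
  · intro s t hs ht h
    split_ifs at h <;> first
        | omega
        | (have := hi _ _ (by omega) (by omega) h; omega)
        | exact (hv _ (by omega) h).elim
        | exact (hv _ (by omega) h.symm).elim

theorem isOff_swap (hp : G.IsIndexedPath x y k p) {v : V} (hv : IsOff k p v) {i : ℕ}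
    (hi : i < k) : IsOff k (fun t => if t = i then v else p t) (p i) := by
  intro t ht
  dsimp only
  split_ifs with h
  · exact (hv i hi).symm
  · exact fun h' => h (hp.inj t i ht hi h')

/-- Move `p (j + 1)`, together with `v`, in between `p i` and `p (i + 1)`. -/
theorem bypass (hp : G.IsIndexedPath x y k p) {v : V} (hv : IsOff k p v) {i j : ℕ}
    (hik : i + 1 < k) (hj : j + 2 < k) (hij : i ≠ j + 1) (hij' : i ≠ j)
    (h₀ : G.Adj (p j) (p (j + 2))) (h₁ : G.Adj v (p i)) (h₂ : G.Adj v (p (j + 1)))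
    (h₃ : G.Adj (p (j + 1)) (p (i + 1))) :
    ∃ f, G.IsIndexedPath x y (k + 1) f := by
  have ha := hp.adj
  have hi := hp.inj
  rcases lt_or_gt_of_ne hij' with h | h
  · refine ⟨fun t => if t ≤ i then p t else if t = i + 1 then v else if t = i + 2 then p (j + 1)
      else if t ≤ j + 2 then p (t - 2) else p (t - 1), ?_⟩
    refine ⟨by omega, ?_, ?_, ?_, ?_⟩
    · simpa using hp.start
    · rw [← hp.finish]; split_ifs <;> first | omega | exact congrArg p (by omega)
    · rintro s t ht rfl
      split_ifs <;> first
          | omega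
          | exact ha _ _ (by omega) (by omega)
          | exact (ha _ _ (by omega) (by omega)).symm
          | exact adj_congr h₂ (by omega)
          | exact adj_congr h₃ (by omega)
          | exact (adj_congr h₁ (by omega)).symm
          | exact adj_congr₂ h₀ (by omega) (by omega)
    · intro s t hs ht h
      split_ifs at h <;> first
          | omega
          | (have := hi _ _ (by omega) (by omega) h; omega)
          | exact (hv _ (by omega) h).elim
          | exact (hv _ (by omega) h.symm).elim
  · refine ⟨fun t => if t ≤ j then p t else if t < i then p (t + 1)
      else if t = i then v else if t = i + 1 then p (j + 1) else p (t - 1), ?_⟩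
    refine ⟨by omega, ?_, ?_, ?_, ?_⟩
    · simpa using hp.start
    · rw [← hp.finish]; split_ifs <;> first | omega | exact congrArg p (by omega)
    · rintro s t ht rfl
      split_ifs <;> first
          | omega
          | exact ha _ _ (by omega) (by omega)
          | exact (ha _ _ (by omega) (by omega)).symm
          | exact adj_congr h₂ (by omega)
          | exact adj_congr h₃ (by omega)
          | exact (adj_congr h₁ (by omega)).symm
          | exact adj_congr₂ h₀ (by omega) (by omega)
    · intro s t hs ht h
      split_ifs at h <;> first
          | omega
          | (have := hi _ _ (by omega) (by omega) h; omega)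
          | exact (hv _ (by omega) h).elim
          | exact (hv _ (by omega) h.symm).elim

/-- Replace `p (i + 1)` by `v` and `u`. -/
theorem swap_two (hp : G.IsIndexedPath x y k p) {u v : V} (hv : IsOff k p v)
    (hu : IsOff k p u) {i : ℕ} (huv : G.Adj v u)
    (hik : i + 2 < k) (h₁ : G.Adj v (p i)) (h₂ : G.Adj u (p (i + 2))) :
    G.IsIndexedPath x y (k + 1)
      (fun t => if t ≤ i then p t else if t = i + 1 then v else if t = i + 2 then u
        else p (t - 1)) := by
  have ha := hp.adj
  have hi := hp.inj
  refine ⟨by omega, ?_, ?_, ?_, ?_⟩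
  · simpa using hp.start
  · rw [← hp.finish]; split_ifs <;> first | omega | exact congrArg p (by omega)
  · rintro s t ht rfl
    split_ifs <;> first
        | omega
        | exact ha _ _ (by omega) (by omega)
        | exact (ha _ _ (by omega) (by omega)).symm
        | exact huv
        | exact adj_congr h₂ (by omega)
        | exact (adj_congr h₁ (by omega)).symm
  · intro s t hs ht h
    split_ifs at h <;> first
        | omega
        | (have := hi _ _ (by omega) (by omega) h; omega)
        | exact (hv _ (by omega) h).elim
        | exact (hv _ (by omega) h.symm).elim
        | exact (hu _ (by omega) h).elim
        | exact (hu _ (by omega) h.symm).elim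
        | exact (huv.ne h).elim
        | exact (huv.ne h.symm).elim

/-- The path `p 0, p (j - 1), …, p 2, v, u, p j, …`. -/
theorem reroute (hp : G.IsIndexedPath x y k p) {u v : V} (hv : IsOff k p v)
    (hu : IsOff k p u) {j : ℕ} (huv : G.Adj v u) (hj : 3 ≤ j)
    (hjk : j < k) (h₀ : G.Adj (p 0) (p (j - 1))) (h₁ : G.Adj v (p 2)) (h₂ : G.Adj u (p j)) :
    G.IsIndexedPath x y (k + 1)
      (fun t => if t = 0 then p 0 else if t + 2 ≤ j then p (j - t) else if t = j - 1 then v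
        else if t = j then u else p (t - 1)) := by
  have ha := hp.adj
  have hi := hp.inj
  refine ⟨by omega, ?_, ?_, ?_, ?_⟩
  · simpa using hp.start
  · rw [← hp.finish]; split_ifs <;> first | omega | exact congrArg p (by omega)
  · rintro s t ht rfl
    split_ifs <;> first
        | omega
        | exact ha _ _ (by omega) (by omega)
        | exact (ha _ _ (by omega) (by omega)).symm
        | exact huv
        | exact adj_congr h₂ (by omega)
        | exact (adj_congr h₁ (by omega)).symm
        | exact adj_congr h₀ (by omega)
        | contradiction
  · intro s t hs ht h
    split_ifs at h <;> first
        | omega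
        | (have := hi _ _ (by omega) (by omega) h; omega)
        | exact (hv _ (by omega) h).elim
        | exact (hv _ (by omega) h.symm).elim
        | exact (hu _ (by omega) h).elim
        | exact (hu _ (by omega) h.symm).elim
        | exact (huv.ne h).elim
        | exact (huv.ne h.symm).elim

end IsIndexedPath

theorem IsGap.reverse (h : G.IsGap x y k) : G.IsGap y x k :=
  ⟨fun _ hp => h.one _ hp.reverse, fun _ hp => h.two _ hp.reverse⟩

theorem IsOff.reverse {v : V} (h : IsOff k p v) : IsOff k (fun i => p (k - 1 - i)) v :=
  fun i hi => h _ (by omega)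

namespace IsIndexedPath

theorem add_one_lt (hp : G.IsIndexedPath x y k p) {v : V} (hy : ¬ G.Adj v y) {i : ℕ} (hi : i < k)
    (h : G.Adj v (p i)) : i + 1 < k := by
  by_contra hk
  obtain rfl : i = k - 1 := by omega
  exact hy (hp.finish ▸ h)

theorem not_adj_succ (hp : G.IsIndexedPath x y k p) (hgap : G.IsGap x y k) {v : V}
    (hv : IsOff k p v) {i : ℕ} (hi : i + 1 < k) (h : G.Adj v (p i)) : ¬ G.Adj v (p (i + 1)) :=
  fun h' => hgap.one _ (hp.insert_one hv hi h h')

theorem not_adj_succ_succ (hp : G.IsIndexedPath x y k p) (hgap : G.IsGap x y k) {v : V}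
    (hv : IsOff k p v) (hy : ¬ G.Adj v y) {i j : ℕ} (hi : i < k) (hj : j < k)
    (h : G.Adj v (p i)) (h' : G.Adj v (p j)) : ¬ G.Adj (p (i + 1)) (p (j + 1)) := by
  intro h''
  have hi' := hp.add_one_lt hy hi h
  have hj' := hp.add_one_lt hy hj h'
  rcases lt_trichotomy i j with hij | rfl | hij
  · exact hgap.one _ (hp.rotate hv hij hj' h h' h'')
  · exact G.irrefl h''
  · exact hgap.one _ (hp.rotate hv hij hi' h' h h''.symm)

/-- A common neighbour of `v` and the successor of a neighbour of `v` lies on the path. -/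
theorem exists_eq_of_adj (hp : G.IsIndexedPath x y k p) (hgap : G.IsGap x y k) {v u : V}
    (hv : IsOff k p v) {i : ℕ} (hi : i + 1 < k) (h : G.Adj v (p i)) (hvu : G.Adj v u)
    (hu : G.Adj (p (i + 1)) u) : ∃ j, j < k ∧ p j = u := by
  by_contra! hoff
  exact hgap.two _ (hp.insert_two hv hoff hvu hi h hu.symm)

end IsIndexedPath

/-- `v` is off the path, and its neighbours are `p 0, p 2, …, p (2 * (q - 1))`. -/
def IsComb (G : SimpleGraph V) (k : ℕ) (p : ℕ → V) (v : V) (q : ℕ) : Prop :=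
  IsOff k p v ∧ 2 ≤ q ∧ 2 * q ≤ k ∧ (∀ i, i < k → (G.Adj v (p i) ↔ ∃ s, s < q ∧ i = 2 * s)) ∧
    ∀ z, G.Adj v z → ∃ s, s < q ∧ z = p (2 * s)

theorem IsComb.adj_start (hp : G.IsIndexedPath x y k p) {v : V} {q : ℕ}
    (h : IsComb G k p v q) : G.Adj v x :=
  hp.start ▸ (h.2.2.2.1 0 hp.pos).mpr ⟨0, by have := h.2.1; omega, rfl⟩

/-! ### Translation between indexed paths and walks. -/

theorem IsIndexedPath.exists_walk {k : ℕ} : ∀ {x y : V} {p : ℕ → V},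
    G.IsIndexedPath x y (k + 1) p →
    ∃ w : G.Walk x y, w.IsPath ∧ w.support = (List.range (k + 1)).map p := by
  induction k with
  | zero =>
    rintro x y p ⟨-, rfl, rfl, -, -⟩
    exact ⟨Walk.nil, by simp, by simp⟩
  | succ k ih =>
    intro x y p hp
    have hq : G.IsIndexedPath (p 1) y (k + 1) (fun i => p (i + 1)) :=
      ⟨by omega, rfl, by simpa using hp.finish, fun i j hj h => hp.adj _ _ (by omega) (by omega),
        fun i j hi hj h => by simpa using hp.inj _ _ (by omega) (by omega) h⟩
    obtain ⟨w, hw, hs⟩ := ih hq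
    obtain rfl := hp.start
    refine ⟨Walk.cons (hp.adj 0 1 (by omega) rfl) w, ?_, ?_⟩
    · rw [Walk.cons_isPath_iff, hs]
      refine ⟨hw, ?_⟩
      simp only [List.mem_map, List.mem_range, not_exists, not_and]
      intro i hi h
      have := hp.inj _ _ (by omega) (by omega) h
      omega
    · rw [Walk.support_cons, hs, List.range_succ_eq_map (n := k + 1)]
      simp [Function.comp_def]

theorem Walk.IsPath.isIndexedPath {w : G.Walk x y} (hw : w.IsPath) :
    G.IsIndexedPath x y (w.length + 1) w.getVert where
  pos := by omega
  start := by simp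
  finish := by simp
  adj i j hj hij := by subst hij; exact w.adj_getVert_succ (by omega)
  inj i j hi hj h := hw.getVert_injOn (by simp; omega) (by simp; omega) h

end Surgery

end SimpleGraph

namespace SimpleGraph

/-! ### Double counting with the `L₁` condition, and the comb structure. -/

section LocalOre

open Finset

/-- The positions of the neighbours of `v` among `p 0, …, p (k - 1)`. -/
def positions {V : Type*} (G : SimpleGraph V) [DecidableRel G.Adj] (k : ℕ) (p : ℕ → V) (v : V) : Finset ℕ :=
  {i ∈ range k | G.Adj v (p i)}

theorem mem_positions {V : Type*} {G : SimpleGraph V} [DecidableRel G.Adj] {k : ℕ} {p : ℕ → V}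
    {v : V} {i : ℕ} :
    i ∈ G.positions k p v ↔ i < k ∧ G.Adj v (p i) := by simp [positions]

variable {V : Type*} [Fintype V] [DecidableEq V] {G : SimpleGraph V} [DecidableRel G.Adj]

/-- Vertices at distance two satisfy the `L₁` condition, in the form of a bound for the private
neighbours of `w`, and have two common neighbours. -/
structure IsLocallyOre (G : SimpleGraph V) [DecidableRel G.Adj] : Prop where
  card_le : ∀ u v w, u ≠ v → ¬ G.Adj u v → G.Adj u w → G.Adj v w →
    #(G.neighborFinset w \ (G.neighborFinset u ∪ G.neighborFinset v)) ≤
      #(G.neighborFinset u ∩ G.neighborFinset v) + 1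
  two_le : ∀ u v w, u ≠ v → ¬ G.Adj u v → G.Adj u w → G.Adj v w →
    2 ≤ #(G.neighborFinset u ∩ G.neighborFinset v)

/-- Split the triple union as `N(u) ∪ N(v)` plus the private neighbours of `w`, and replace `d(u) +
d(v)` by `|N(u) ∪ N(v)| + |N(u) ∩ N(v)|`. -/
theorem IsLGraph.isLocallyOre (hL : G.IsLGraph 1)
    (hcommon : ∀ u v : V, G.dist u v = 2 →
      2 ≤ #(G.neighborFinset u ∩ G.neighborFinset v)) : G.IsLocallyOre := by
  have hdist : ∀ u v w, u ≠ v → ¬ G.Adj u v → G.Adj u w → G.Adj v w → G.dist u v = 2 := by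
    intro u v w huv hnadj hu hv
    let q : G.Walk u v := Walk.cons hu (Walk.cons hv.symm Walk.nil)
    have h1 := q.reachable.one_lt_dist_of_ne_of_not_adj huv hnadj
    have h2 : G.dist u v ≤ 2 := dist_le q
    omega
  refine ⟨fun u v w huv hnadj hu hv => ?_,
    fun u v w huv hnadj hu hv => hcommon u v (hdist u v w huv hnadj hu hv)⟩
  have h := hL u v w (hdist u v w huv hnadj hu hv) (by simp [hu, hv])
  rw [← card_neighborFinset_eq_degree, ← card_neighborFinset_eq_degree,
    union_comm _ (G.neighborFinset w), ← card_sdiff_add_card] at h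
  have := card_union_add_card_inter (G.neighborFinset u) (G.neighborFinset v)
  omega

theorem IsLocallyOre.exists_ne (hG : G.IsLocallyOre) {u v w : V} (huv : u ≠ v)
    (h : ¬ G.Adj u v) (hu : G.Adj u w) (hv : G.Adj v w) :
    ∃ z, z ≠ w ∧ G.Adj u z ∧ G.Adj v z := by
  obtain ⟨z, hz, hzw⟩ := exists_mem_ne (hG.two_le u v w huv h hu hv) w
  simp only [mem_inter, mem_neighborFinset] at hz
  exact ⟨z, hzw, hz.1, hz.2⟩

variable {x y : V} {k : ℕ} {p : ℕ → V}

namespace IsIndexedPath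

theorem inter_eq_image (hp : G.IsIndexedPath x y k p) (hgap : G.IsGap x y k) {v : V}
    (hv : IsOff k p v) {i : ℕ} (hi : i + 1 < k) (h : G.Adj v (p i)) :
    G.neighborFinset v ∩ G.neighborFinset (p (i + 1)) =
      {j ∈ G.positions k p v | G.Adj (p (i + 1)) (p j)}.image p := by
  ext u
  simp only [mem_inter, mem_neighborFinset, mem_image, mem_filter, mem_positions]
  constructor
  · rintro ⟨h1, h2⟩
    obtain ⟨j, hj, rfl⟩ := hp.exists_eq_of_adj hgap hv hi h h1 h2
    exact ⟨j, ⟨⟨hj, h1⟩, h2⟩, rfl⟩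
  · rintro ⟨j, ⟨⟨hj, h1⟩, h2⟩, rfl⟩
    exact ⟨h1, h2⟩

theorem card_inter (hp : G.IsIndexedPath x y k p) (hgap : G.IsGap x y k) {v : V}
    (hv : IsOff k p v) {i : ℕ} (hi : i + 1 < k) (h : G.Adj v (p i)) :
    #(G.neighborFinset v ∩ G.neighborFinset (p (i + 1))) =
      #{j ∈ G.positions k p v | G.Adj (p (i + 1)) (p j)} := by
  rw [hp.inter_eq_image hgap hv hi h, card_image_of_injOn]
  intro a ha b hb hab
  simp only [coe_filter, Set.mem_ofPred_eq, mem_positions] at ha hb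
  exact hp.inj _ _ ha.1.1 hb.1.1 hab

/-- Insertion prevents `v` from seeing two consecutive vertices; rotation keeps successors of
neighbours of `v` pairwise nonadjacent. -/
theorem insert_image_subset (hp : G.IsIndexedPath x y k p) (hgap : G.IsGap x y k) {v : V}
    (hv : IsOff k p v) (hy : ¬ G.Adj v y) {i : ℕ} (hi : i + 1 < k) (h : G.Adj v (p i)) :
    insert v ({j ∈ G.positions k p v | G.Adj (p i) (p (j + 1))}.image fun j => p (j + 1)) ⊆
      G.neighborFinset (p i) \ (G.neighborFinset v ∪ G.neighborFinset (p (i + 1))) := by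
  intro u
  simp only [mem_insert, mem_image, mem_filter, mem_positions, mem_sdiff, mem_union,
    mem_neighborFinset, not_or]
  rintro (rfl | ⟨j, ⟨⟨hj, h1⟩, h2⟩, rfl⟩)
  · exact ⟨h.symm, G.irrefl, fun h' => hp.not_adj_succ hgap hv hi h h'.symm⟩
  · exact ⟨h2, hp.not_adj_succ hgap hv (hp.add_one_lt hy hj h1) h1,
      hp.not_adj_succ_succ hgap hv hy (by omega) hj h h1⟩

theorem card_insert_image (hp : G.IsIndexedPath x y k p) {v : V}
    (hv : IsOff k p v) (hy : ¬ G.Adj v y) (i : ℕ) :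
    #(insert v ({j ∈ G.positions k p v | G.Adj (p i) (p (j + 1))}.image fun j => p (j + 1))) =
      #{j ∈ G.positions k p v | G.Adj (p i) (p (j + 1))} + 1 := by
  rw [card_insert_of_notMem, card_image_of_injOn]
  · intro a ha b hb hab
    simp only [coe_filter, Set.mem_ofPred_eq, mem_positions] at ha hb
    have := hp.inj _ _ (hp.add_one_lt hy ha.1.1 ha.1.2) (hp.add_one_lt hy hb.1.1 hb.1.2) hab
    omega
  · simp only [mem_image, mem_filter, mem_positions, not_exists, not_and]
    rintro j ⟨⟨hj, h1⟩, -⟩ h2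
    exact hv _ (hp.add_one_lt hy hj h1) h2

/-- Summing the `L₁` condition over the neighbours of `v` on the path shows that it is tight. -/
theorem card_filter_eq (hp : G.IsIndexedPath x y k p) (hG : G.IsLocallyOre)
    (hgap : G.IsGap x y k) {v : V} (hv : IsOff k p v) (hy : ¬ G.Adj v y) :
    ∀ i ∈ G.positions k p v, #{j ∈ G.positions k p v | G.Adj (p i) (p (j + 1))} =
      #{j ∈ G.positions k p v | G.Adj (p (i + 1)) (p j)} := by
  refine (sum_eq_sum_iff_of_le fun i hi => ?_).mp ?_
  · rw [mem_positions] at hi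
    have hi' := hp.add_one_lt hy hi.1 hi.2
    have h1 := card_le_card (hp.insert_image_subset hgap hv hy hi' hi.2)
    rw [hp.card_insert_image hv hy] at h1
    have h2 := hG.card_le v (p (i + 1)) (p i) (hv _ hi').symm
      (hp.not_adj_succ hgap hv hi' hi.2) hi.2 (hp.adj _ _ hi' rfl).symm
    rw [hp.card_inter hgap hv hi' hi.2] at h2
    omega
  -- Both sums count the adjacent pairs `p i`, `p (j + 1)`, grouped by `i` or by `j`.
  · have := sum_card_bipartiteAbove_eq_sum_card_bipartiteBelow (s := G.positions k p v)
      (t := G.positions k p v) (fun i j => G.Adj (p i) (p (j + 1)))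
    simp only [bipartiteAbove, bipartiteBelow] at this
    rw [this]
    simp only [G.adj_comm]

theorem two_le_card_filter (hp : G.IsIndexedPath x y k p) (hG : G.IsLocallyOre)
    (hgap : G.IsGap x y k) {v : V} (hv : IsOff k p v) {i : ℕ} (hi : i + 1 < k)
    (h : G.Adj v (p i)) : 2 ≤ #{j ∈ G.positions k p v | G.Adj (p (i + 1)) (p j)} := by
  rw [← hp.card_inter hgap hv hi h]
  exact hG.two_le v (p (i + 1)) (p i) (hv _ hi).symm (hp.not_adj_succ hgap hv hi h) h
    (hp.adj _ _ hi rfl).symm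

theorem exists_adj_pred (hp : G.IsIndexedPath x y k p) (hG : G.IsLocallyOre)
    (hgap : G.IsGap x y k) {v : V} (hv : IsOff k p v) {i : ℕ} (hi : i + 1 < k)
    (h : G.Adj v (p i)) : ∃ j, j ≠ i ∧ j < k ∧ G.Adj v (p j) ∧ G.Adj (p (i + 1)) (p j) := by
  obtain ⟨j, hj, hji⟩ := exists_mem_ne (hp.two_le_card_filter hG hgap hv hi h) i
  rw [mem_filter, mem_positions] at hj
  exact ⟨j, hji, hj.1.1, hj.1.2, hj.2⟩

theorem exists_adj_succ (hp : G.IsIndexedPath x y k p) (hG : G.IsLocallyOre)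
    (hgap : G.IsGap x y k) {v : V} (hv : IsOff k p v) (hy : ¬ G.Adj v y) {i : ℕ} (hi : i < k)
    (h : G.Adj v (p i)) : ∃ j, j ≠ i ∧ j < k ∧ G.Adj v (p j) ∧ G.Adj (p i) (p (j + 1)) := by
  have h2 := hp.two_le_card_filter hG hgap hv (hp.add_one_lt hy hi h) h
  rw [← hp.card_filter_eq hG hgap hv hy i (mem_positions.mpr ⟨hi, h⟩)] at h2
  obtain ⟨j, hj, hji⟩ := exists_mem_ne h2 i
  rw [mem_filter, mem_positions] at hj
  exact ⟨j, hji, hj.1.1, hj.1.2, hj.2⟩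

/-- The neighbours of a neighbour `p i` of `v`. -/
theorem eq_or_adj_of_adj (hp : G.IsIndexedPath x y k p) (hG : G.IsLocallyOre)
    (hgap : G.IsGap x y k) {v : V} (hv : IsOff k p v) (hy : ¬ G.Adj v y) {i : ℕ} (hi : i < k)
    (h : G.Adj v (p i)) {z : V} (hz : G.Adj (p i) z) :
    z = v ∨ G.Adj v z ∨ G.Adj (p (i + 1)) z ∨ ∃ j, j < k ∧ G.Adj v (p j) ∧ p (j + 1) = z := by
  have hi' := hp.add_one_lt hy hi h
  -- Tightness turns the inclusion of private neighbours into an equality.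
  have heq := eq_of_subset_of_card_le (hp.insert_image_subset hgap hv hy hi' h) <| by
    rw [hp.card_insert_image hv hy,
      hp.card_filter_eq hG hgap hv hy i (mem_positions.mpr ⟨hi, h⟩), ← hp.card_inter hgap hv hi' h]
    exact hG.card_le v (p (i + 1)) (p i) (hv _ hi').symm
      (hp.not_adj_succ hgap hv hi' h) h (hp.adj _ _ hi' rfl).symm
  by_cases h1 : G.Adj v z
  · exact .inr (.inl h1)
  by_cases h2 : G.Adj (p (i + 1)) z
  · exact .inr (.inr (.inl h2))
  have hmem : z ∈ G.neighborFinset (p i) \ (G.neighborFinset v ∪ G.neighborFinset (p (i + 1))) := by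
    simp [hz, h1, h2]
  rw [← heq] at hmem
  simp only [mem_insert, mem_image, mem_filter, mem_positions] at hmem
  obtain h3 | ⟨j, ⟨⟨hj, h3⟩, -⟩, h4⟩ := hmem
  · exact .inl h3
  · exact .inr (.inr (.inr ⟨j, hj, h3, h4⟩))

/-- A neighbour of `v` on the path is the first vertex or two steps after another one. -/
theorem adj_sub_two (hp : G.IsIndexedPath x y k p) (hG : G.IsLocallyOre)
    (hgap : G.IsGap x y k) {v : V} (hv : IsOff k p v) (hy : ¬ G.Adj v y) {i : ℕ} (hi : i + 1 < k)
    (h : G.Adj v (p (i + 1))) : ∃ j, i = j + 1 ∧ G.Adj v (p j) := by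
  have hi' := hp.add_one_lt hy hi h
  rcases hp.eq_or_adj_of_adj hG hgap hv hy hi h (hp.adj i _ hi rfl).symm with h1 | h1 | h1 | h1
  · exact (hv i (by omega) h1).elim
  · exact (hp.not_adj_succ hgap hv hi h1 h).elim
  -- The chord from `p i` to `p (i + 2)` frees `p (i + 1)`, which can be moved with `v` between `p
  -- j` and `p (j + 1)`.
  · obtain ⟨j, hj, hjk, h2, h3⟩ := hp.exists_adj_succ hG hgap hv hy hi h
    have hji : j ≠ i := by
      rintro rfl
      exact hp.not_adj_succ hgap hv hi h2 h
    obtain ⟨f, hf⟩ := hp.bypass hv (hp.add_one_lt hy hjk h2) hi' hj hji h1.symm h2 h h3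
    exact (hgap.one _ hf).elim
  · obtain ⟨j, hj, h2, h3⟩ := h1
    exact ⟨j, (hp.inj _ _ (hp.add_one_lt hy hj h2) (by omega) h3).symm, h2⟩

theorem even_and_adj (hp : G.IsIndexedPath x y k p) (hG : G.IsLocallyOre)
    (hgap : G.IsGap x y k) {v : V} (hv : IsOff k p v) (hy : ¬ G.Adj v y) :
    ∀ i, i < k → G.Adj v (p i) → ∃ s, i = 2 * s ∧ ∀ t ≤ s, G.Adj v (p (2 * t)) := by
  intro i
  induction i using Nat.strong_induction_on with
  | _ i ih =>
    intro hi h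
    rcases i with _ | i
    · exact ⟨0, rfl, fun t ht => by obtain rfl : t = 0 := by omega
                                    exact h⟩
    · obtain ⟨j, rfl, hj⟩ := hp.adj_sub_two hG hgap hv hy hi h
      obtain ⟨s, rfl, hs⟩ := ih j (by omega) (by omega) hj
      refine ⟨s + 1, by ring, fun t ht => ?_⟩
      rcases Nat.lt_or_ge t (s + 1) with h1 | h1
      · exact hs t (by omega)
      · obtain rfl : t = s + 1 := by omega
        exact h

/-- A vertex off the path that is not adjacent to the last vertex but to some vertex of the path
is adjacent to every other vertex of an initial segment, and to nothing else on the path. -/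
theorem exists_adj_iff (hp : G.IsIndexedPath x y k p) (hG : G.IsLocallyOre)
    (hgap : G.IsGap x y k) {v : V} (hv : IsOff k p v) (hy : ¬ G.Adj v y)
    (h : ∃ i, i < k ∧ G.Adj v (p i)) :
    ∃ q, 2 ≤ q ∧ 2 * q ≤ k ∧ ∀ i, i < k → (G.Adj v (p i) ↔ ∃ s, s < q ∧ i = 2 * s) := by
  obtain ⟨i, hi, h⟩ := h
  -- The number of teeth is the first `s` that fails; `s = k` fails for being out of range.
  have hex : ∃ s, ¬ (2 * s < k ∧ G.Adj v (p (2 * s))) := ⟨k, by omega⟩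
  classical
  let q := Nat.find hex
  have hq : ∀ s, s < q → 2 * s < k ∧ G.Adj v (p (2 * s)) :=
    fun s hs => not_not.mp (Nat.find_min hex hs)
  have hq' : ¬ (2 * q < k ∧ G.Adj v (p (2 * q))) := Nat.find_spec hex
  have key : ∀ i, i < k → (G.Adj v (p i) ↔ ∃ s, s < q ∧ i = 2 * s) := by
    intro i hi
    constructor
    · intro h
      obtain ⟨s, rfl, hs⟩ := hp.even_and_adj hG hgap hv hy i hi h
      refine ⟨s, ?_, rfl⟩
      by_contra hsq
      exact hq' ⟨by omega, hs q (by omega)⟩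
    · rintro ⟨s, hs, rfl⟩
      exact (hq s hs).2
  have h2 : 2 ≤ q := by
    obtain ⟨j, hj, hjk, h2, -⟩ := hp.exists_adj_succ hG hgap hv hy hi h
    obtain ⟨s, hs, rfl⟩ := (key i hi).mp h
    obtain ⟨t, ht, rfl⟩ := (key j hjk).mp h2
    omega
  refine ⟨q, h2, ?_, key⟩
  have h3 := hq (q - 1) (by omega)
  have := hp.add_one_lt hy h3.1 h3.2
  omega

end IsIndexedPath

end LocalOre

end SimpleGraph

namespace SimpleGraph

/-! ### Vertices off the path. -/

section Extension

open Finset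

variable {V : Type*} [Fintype V] [DecidableEq V] {G : SimpleGraph V} [DecidableRel G.Adj]
  {x y : V} {k : ℕ} {p : ℕ → V}

namespace IsIndexedPath

/-- If `v` sees `u`, then `u` and `p 0` are at distance two and have a common neighbour `z ≠ v`.
Wherever `z` lies, `u` and `v` can be used to lengthen the path. -/
theorem not_adj_of_isOff_of_not_adj (hp : G.IsIndexedPath x y k p) (hG : G.IsLocallyOre)
    (hgap : G.IsGap x y k) {u v : V} (hv : IsOff k p v) (hu : IsOff k p u) (hy : ¬ G.Adj v y)
    (h : ∃ i, i < k ∧ G.Adj v (p i)) : ¬ G.Adj v u := by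
  intro huv
  obtain ⟨q, hq, hqk, hvq⟩ := hp.exists_adj_iff hG hgap hv hy h
  have hv0 : G.Adj v (p 0) := (hvq 0 (by omega)).mpr ⟨0, by omega, rfl⟩
  have hv2 : G.Adj v (p 2) := (hvq 2 (by omega)).mpr ⟨1, by omega, rfl⟩
  have triangle : ∀ z, IsOff k p z → G.Adj v z → ¬ G.Adj z (p 0) := fun z hz hvz hz0 =>
    hgap.one _ (hp.swap_two hz hv hvz.symm (by omega) hz0 hv2)
  have hu0 := triangle u hu huv
  obtain ⟨z, hzv, huz, hz0⟩ := hG.exists_ne (hu 0 (by omega)).symm hu0 huv.symm hv0.symm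
  by_cases hz : IsOff k p z
  · rcases hp.eq_or_adj_of_adj hG hgap hv hy (by omega) hv0 hz0 with h1 | h1 | h1 | h1
    · exact hzv h1
    · exact triangle z hz h1 hz0.symm
    · exact hgap.one _ (hp.insert_one hz (by omega) hz0.symm h1.symm)
    · obtain ⟨j, hj, h2, h3⟩ := h1
      exact hz _ (hp.add_one_lt hy hj h2) h3
  · unfold IsOff at hz
    push Not at hz
    obtain ⟨j, hj, rfl⟩ := hz
    have hjq : 2 * q ≤ j := by
      by_contra hjq
      obtain ⟨s, hs | hs⟩ := j.even_or_odd'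
      · rcases s with _ | s
        · exact hu0 (by simpa [hs] using huz)
        · subst hs
          exact hgap.one _ (hp.swap_two hv hu (i := 2 * s) huv hj
            ((hvq _ (by omega)).mpr ⟨s, by omega, rfl⟩) huz)
      · subst hs
        exact hgap.two _ (hp.insert_two hv hu (i := 2 * s) huv hj
            ((hvq _ (by omega)).mpr ⟨s, by omega, rfl⟩) huz)
    -- Beyond the teeth of `v`, tightness is applied to `u` along the reversed path, where `x` is
    -- the last vertex.
    have hx : ¬ G.Adj u x := hp.start ▸ hu0
    have hj' : p (k - 1 - (k - 1 - j)) = p j := congrArg p (by omega)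
    rcases hp.reverse.eq_or_adj_of_adj hG hgap.reverse hu.reverse hx (i := k - 1 - j) (by omega)
      (by rwa [hj']) (z := p 0) (by rw [hj']; exact hz0.symm) with h1 | h1 | h1 | h1
    · exact hu 0 (by omega) h1
    · exact hu0 h1
    · exact hgap.one _ (hp.reroute hv hu huv (by omega) hj
        (adj_congr h1.symm (by omega)) hv2 huz)
    · obtain ⟨i, hi, h2, h3⟩ := h1
      have h4 := hp.inj _ _ (by omega) (by omega) h3
      -- Truncated subtraction makes the reversed successor of `p 0` equal to `p 0`, whence the
      -- second case.
      rcases Nat.lt_or_ge i (k - 1) with h5 | h5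
      · exact hgap.two _ (hp.insert_two hv hu huv (i := 0) (by omega) hv0
          (adj_congr h2 (by omega)))
      · exact hu0 (adj_congr h2 (by omega))

/-- A vertex off the path with a neighbour on the path has no neighbour off the path. -/
theorem not_adj_of_isOff (hp : G.IsIndexedPath x y k p) (hG : G.IsLocallyOre)
    (hgap : G.IsGap x y k) (hxy : ∀ z, G.Adj z x → ¬ G.Adj z y)
    {u v : V} (hv : IsOff k p v) (hu : IsOff k p u)
    (h : ∃ i, i < k ∧ G.Adj v (p i)) : ¬ G.Adj v u := by
  by_cases hy : G.Adj v y
  · obtain ⟨i, hi, h⟩ := h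
    exact hp.reverse.not_adj_of_isOff_of_not_adj hG hgap.reverse hv.reverse hu.reverse
      (fun hx => hxy v hx hy) ⟨k - 1 - i, by omega, adj_congr h (by omega)⟩
  · exact hp.not_adj_of_isOff_of_not_adj hG hgap hv hu hy h

/-- Otherwise a walk from `v` to `x` could never enter the path: by `not_adj_of_isOff`, having no
neighbour on the path propagates along it. -/
theorem exists_adj_of_isOff (hp : G.IsIndexedPath x y k p) (hG : G.IsLocallyOre)
    (hgap : G.IsGap x y k) (hxy : ∀ z, G.Adj z x → ¬ G.Adj z y) (hconn : G.Connected)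
    {v : V} (hv : IsOff k p v) : ∃ i, i < k ∧ G.Adj v (p i) := by
  by_contra hne
  have key : ∀ a b : V, G.Walk a b → IsOff k p a → (¬ ∃ i, i < k ∧ G.Adj a (p i)) →
      IsOff k p b := by
    intro a b w
    induction w with
    | nil => exact fun h _ => h
    | @cons a c b hac w ih =>
      intro ha hna
      have hc : IsOff k p c := fun i hi hic => hna ⟨i, hi, hic ▸ hac⟩
      exact ih hc fun h => hp.not_adj_of_isOff hG hgap hxy hc ha h hac.symm
  obtain ⟨w⟩ := hconn.preconnected v x
  exact key v x w hv hne 0 hp.pos hp.start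

/-- Distinct vertices off the path have no common neighbour on the path. -/
theorem eq_of_adj (hp : G.IsIndexedPath x y k p) (hG : G.IsLocallyOre)
    (hgap : G.IsGap x y k) (hxy : ∀ z, G.Adj z x → ¬ G.Adj z y)
    {u v : V} (hv : IsOff k p v) (hu : IsOff k p u) {i : ℕ} (hi : i < k) (h : G.Adj v (p i))
    (h' : G.Adj u (p i)) : u = v := by
  have key : ∀ {x y : V} {p : ℕ → V} {i : ℕ}, G.IsIndexedPath x y k p → G.IsGap x y k →
      (∀ z, G.Adj z x → ¬ G.Adj z y) → IsOff k p v → IsOff k p u → i < k →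
      G.Adj v (p i) → G.Adj u (p i) → ¬ G.Adj v y → u = v := by
    intro x y p i hp hgap hxy hv hu hi h h' hy
    rcases hp.eq_or_adj_of_adj hG hgap hv hy hi h h'.symm with h1 | h1 | h1 | h1
    · exact h1
    · exact (hp.not_adj_of_isOff hG hgap hxy hv hu ⟨i, hi, h⟩ h1).elim
    · exact (hgap.one _ (hp.insert_one hu (hp.add_one_lt hy hi h) h' h1.symm)).elim
    · obtain ⟨j, hj, h2, h3⟩ := h1
      exact (hu _ (hp.add_one_lt hy hj h2) h3).elim
  by_cases hy : G.Adj v y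
  · exact key hp.reverse hgap.reverse (fun z hzy hzx => hxy z hzx hzy) hv.reverse hu.reverse
      (i := k - 1 - i) (by omega) (adj_congr h (by omega)) (adj_congr h' (by omega))
      fun hx => hxy v hx hy
  · exact key hp hgap hxy hv hu hi h h' hy

theorem adj_start_or_finish (hp : G.IsIndexedPath x y k p) (hG : G.IsLocallyOre)
    (hgap : G.IsGap x y k) (hxy : ∀ z, G.Adj z x → ¬ G.Adj z y) (hconn : G.Connected)
    {v : V} (hv : IsOff k p v) : G.Adj v x ∨ G.Adj v y := by
  by_contra! h
  obtain ⟨q, hq, hqk, hvq⟩ := hp.exists_adj_iff hG hgap hv h.2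
    (hp.exists_adj_of_isOff hG hgap hxy hconn hv)
  exact h.1 (hp.start ▸ (hvq 0 (by omega)).mpr ⟨0, by omega, rfl⟩)

theorem exists_isOff_ne (hcard : k + 2 ≤ Fintype.card V) (p : ℕ → V) (v : V) :
    ∃ u, u ≠ v ∧ IsOff k p u := by
  have h1 : #(insert v ((range k).image p)) < #(univ : Finset V) := by
    have := card_insert_le v ((range k).image p)
    have := card_image_le (s := range k) (f := p)
    rw [card_range] at this
    rw [card_univ]
    omega
  obtain ⟨u, -, hu⟩ := exists_mem_notMem_of_card_lt_card h1
  simp only [mem_insert, mem_image, mem_range, not_or, not_exists, not_and] at hu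
  exact ⟨u, hu.1, fun i hi => hu.2 i hi⟩

theorem exists_isComb (hp : G.IsIndexedPath x y k p) (hG : G.IsLocallyOre)
    (hgap : G.IsGap x y k) (hxy : ∀ z, G.Adj z x → ¬ G.Adj z y) (hconn : G.Connected)
    {v : V} (hv : IsOff k p v) (hy : ¬ G.Adj v y) : ∃ q, IsComb G k p v q := by
  have hex := hp.exists_adj_of_isOff hG hgap hxy hconn hv
  obtain ⟨q, hq, hqk, hvq⟩ := hp.exists_adj_iff hG hgap hv hy hex
  refine ⟨q, hv, hq, hqk, hvq, fun z hz => ?_⟩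
  by_cases hoff : IsOff k p z
  · exact (hp.not_adj_of_isOff hG hgap hxy hv hoff hex hz).elim
  · unfold IsOff at hoff
    push Not at hoff
    obtain ⟨j, hj, rfl⟩ := hoff
    obtain ⟨s, hs, rfl⟩ := (hvq j hj).mp hz
    exact ⟨s, hs, rfl⟩

/-- At most one vertex off the path sees `x`, so a second one must see `y`. -/
theorem exists_adj_finish (hp : G.IsIndexedPath x y k p) (hG : G.IsLocallyOre)
    (hgap : G.IsGap x y k) (hxy : ∀ z, G.Adj z x → ¬ G.Adj z y) (hconn : G.Connected)
    (hcard : k + 2 ≤ Fintype.card V) {v : V} (hv : IsOff k p v) (hx : G.Adj v x) :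
    ∃ u, u ≠ v ∧ IsOff k p u ∧ G.Adj u y := by
  obtain ⟨u, huv, hu⟩ := exists_isOff_ne hcard p v
  refine ⟨u, huv, hu, (hp.adj_start_or_finish hG hgap hxy hconn hu).resolve_left fun h => huv ?_⟩
  exact hp.eq_of_adj hG hgap hxy hv hu hp.pos (hp.start.symm ▸ hx) (hp.start.symm ▸ h)

end IsIndexedPath

/-! ### Contradiction from a comb with the most teeth. -/

/-- If `q` is largest possible, then the neighbours of `p 1, p 3, …, p (2 * q - 3)` are among those
of `v`. -/
theorem IsComb.eq_of_adj_odd {v : V} {q : ℕ} (h : IsComb G k p v q)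
    (hp : G.IsIndexedPath x y k p) (hG : G.IsLocallyOre)
    (hgap : G.IsGap x y k) (hxy : ∀ z, G.Adj z x → ¬ G.Adj z y) (hconn : G.Connected)
    (hcard : k + 2 ≤ Fintype.card V)
    (hmax : ∀ p v q', G.IsIndexedPath x y k p → IsComb G k p v q' → q' ≤ q) {i : ℕ}
    (hi : i + 1 < q) {z : V} (hz : G.Adj (p (2 * i + 1)) z) : ∃ s, s < q ∧ z = p (2 * s) := by
  obtain ⟨u, huv, hu, huy⟩ := hp.exists_adj_finish hG hgap hxy hconn hcard h.1 (h.adj_start hp)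
  have ⟨hv, hq, hqk, hvq, _⟩ := h
  have hp' := hp.swap hv (i := 2 * i) (by omega) ((hvq _ (by omega)).mpr ⟨i, by omega, rfl⟩)
    ((hvq _ (by omega)).mpr ⟨i + 1, by omega, by ring⟩)
  have hw := hp.isOff_swap hv (i := 2 * i + 1) (by omega)
  have hu' : IsOff k (fun t => if t = 2 * i + 1 then v else p t) u := by
    intro t ht
    dsimp only
    split_ifs
    · exact huv.symm
    · exact hu t ht
  -- After the exchange `u` is still off the path and already sees `y`.
  have hwy : ¬ G.Adj (p (2 * i + 1)) y := by
    intro hwy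
    refine hu (2 * i + 1) (by omega) (hp'.eq_of_adj hG hgap hxy hw hu' (i := k - 1) (by omega) ?_ ?_).symm
    · rwa [hp'.finish]
    · rwa [hp'.finish]
  obtain ⟨q', hw'⟩ := hp'.exists_isComb hG hgap hxy hconn hw hwy
  obtain ⟨s, hs, rfl⟩ := hw'.2.2.2.2 z hz
  have := hmax _ _ _ hp' hw'
  exact ⟨s, by omega, if_neg (by omega)⟩

namespace IsIndexedPath

theorem not_isComb (hp : G.IsIndexedPath x y k p) (hG : G.IsLocallyOre)
    (hgap : G.IsGap x y k) (hxy : ∀ z, G.Adj z x → ¬ G.Adj z y) (hconn : G.Connected)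
    (hcard : k + 2 ≤ Fintype.card V) {v : V} {q : ℕ} (h : IsComb G k p v q)
    (hmax : ∀ p v q', G.IsIndexedPath x y k p → IsComb G k p v q' → q' ≤ q) : False := by
  have hx := h.adj_start hp
  have hy := hxy v hx
  have ⟨hv, hq, hqk, hvq, hvn⟩ := h
  have hodd : ∀ i, i + 1 < q → ∀ z, G.Adj (p (2 * i + 1)) z → ∃ s, s < q ∧ z = p (2 * s) :=
    fun i hi z hz => h.eq_of_adj_odd hp hG hgap hxy hconn hcard hmax hi hz
  -- If `2 * q = k`, the comb of `u` hanging from `y` has the tooth `p (2 * q - 3)`, which is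
  -- adjacent only to teeth of `v`.
  have hlt : 2 * q < k := by
    by_contra hk
    obtain ⟨u, huv, hu, huy⟩ := hp.exists_adj_finish hG hgap hxy hconn hcard hv hx
    obtain ⟨r, hr, hrk, hur⟩ := hp.reverse.exists_adj_iff hG hgap.reverse hu.reverse
      (fun hux => hxy u hux huy) ⟨0, hp.pos, by simpa [hp.finish] using huy⟩
    have h1 := (hur 2 (by omega)).mpr ⟨1, by omega, rfl⟩
    obtain ⟨s, hs, rfl⟩ := hodd (q - 2) (by omega) u (adj_congr h1 (by omega)).symm
    exact hu (2 * s) (by omega) rfl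
  have heven : ∀ i, i < q → ∀ z, G.Adj (p (2 * i)) z → i + 1 < q →
      z = v ∨ ∃ t, t < 2 * q ∧ z = p t := by
    intro i hi z hz hiq
    rcases hp.eq_or_adj_of_adj hG hgap hv hy (by omega)
      ((hvq (2 * i) (by omega)).mpr ⟨i, hi, rfl⟩) hz with h1 | h1 | h1 | h1
    · exact .inl h1
    · obtain ⟨s, hs, rfl⟩ := hvn z h1
      exact .inr ⟨2 * s, by omega, rfl⟩
    · obtain ⟨s, hs, rfl⟩ := hodd i hiq z h1
      exact .inr ⟨2 * s, by omega, rfl⟩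
    · obtain ⟨j, hj, h2, rfl⟩ := h1
      obtain ⟨s, hs, rfl⟩ := (hvq j hj).mp h2
      exact .inr ⟨2 * s + 1, by omega, rfl⟩
  have hvend : ¬ G.Adj v (p (2 * q)) := by
    intro hvend
    obtain ⟨s, hs, h1⟩ := (hvq _ hlt).mp hvend
    omega
  have hfar : ∀ i, i + 1 < q → ¬ G.Adj (p (2 * i)) (p (2 * q)) := by
    intro i hi hadj
    rcases heven i (by omega) _ hadj hi with h1 | ⟨t, ht, h1⟩
    · exact hv _ hlt h1
    · have := hp.inj _ _ hlt (by omega) h1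
      omega
  -- From here on the last tooth is `p (2 * q)`, and `p (2 * (q + 1))` is the first vertex beyond
  -- the comb.
  obtain ⟨q, rfl⟩ : ∃ r, q = r + 1 := ⟨q - 1, by omega⟩
  have hvq' : G.Adj v (p (2 * q)) := (hvq _ (by omega)).mpr ⟨q, by omega, rfl⟩
  obtain ⟨j, hj, hjk, hvj, hadj⟩ := hp.exists_adj_pred hG hgap hv (i := 2 * q) (by omega) hvq'
  obtain ⟨s, hs, rfl⟩ := (hvq j hjk).mp hvj
  have hnear : ¬ G.Adj (p (2 * q)) (p (2 * (q + 1))) := by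
    intro hnear
    obtain ⟨c, hc, hvc, hc'⟩ := hG.exists_ne (hv _ hlt).symm hvend hvq' hnear.symm
    obtain ⟨t, ht, rfl⟩ := hvn c hvc
    refine hfar t ?_ hc'.symm
    rcases Nat.lt_or_ge t q with h1 | h1
    · omega
    · obtain rfl : t = q := by omega
      exact (hc rfl).elim
  -- The tooth `p (2 * s)` and `p (2 * (q + 1))` share `p (2 * q + 1)`; no position remains for a
  -- second common neighbour `c`.
  obtain ⟨c, hc, hsc, hc'⟩ := hG.exists_ne
    (fun he => by have := hp.inj _ _ (by omega) hlt he; omega)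
    (hfar s (by omega)) hadj.symm (hp.adj (2 * q + 1) (2 * (q + 1)) hlt (by ring)).symm
  rcases heven s hs c hsc (by omega) with rfl | ⟨t, ht, rfl⟩
  · exact hvend hc'.symm
  · obtain ⟨i, rfl | rfl⟩ := t.even_or_odd'
    · rcases Nat.lt_or_ge i q with h1 | h1
      · exact hfar i (by omega) hc'.symm
      · obtain rfl : i = q := by omega
        exact hnear hc'.symm
    · rcases Nat.lt_or_ge i q with h1 | h1
      · obtain ⟨t, ht, h2⟩ := hodd i (by omega) _ hc'.symm
        have := hp.inj _ _ hlt (by omega) h2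
        omega
      · obtain rfl : i = q := by omega
        exact hc rfl

/-- A path missing at least two vertices can be replaced by one with one or two more vertices. -/
theorem not_isGap (hp : G.IsIndexedPath x y k p) (hG : G.IsLocallyOre)
    (hxy : ∀ z, G.Adj z x → ¬ G.Adj z y) (hconn : G.Connected)
    (hcard : k + 2 ≤ Fintype.card V) : ¬ G.IsGap x y k := by
  intro hgap
  -- At most one vertex off the path sees `y`, and there are at least two off the path.
  have hex : ∃ v, IsOff k p v ∧ ¬ G.Adj v y := by
    obtain ⟨a, -, ha⟩ := exists_isOff_ne hcard p x
    by_cases hay : G.Adj a y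
    · obtain ⟨b, hba, hb⟩ := exists_isOff_ne hcard p a
      refine ⟨b, hb, fun hby => hba ?_⟩
      have := hp.pos
      exact hp.eq_of_adj hG hgap hxy ha hb (i := k - 1) (by omega) (by rwa [hp.finish])
        (by rwa [hp.finish])
    · exact ⟨a, ha, hay⟩
  obtain ⟨v, hv, hy⟩ := hex
  obtain ⟨q, hq⟩ := hp.exists_isComb hG hgap hxy hconn hv hy
  let S : Set ℕ := {q | ∃ p v, G.IsIndexedPath x y k p ∧ IsComb G k p v q}
  have hbdd : BddAbove S := ⟨k, fun q ⟨_, _, _, h⟩ => by have := h.2.2.1; omega⟩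
  obtain ⟨p', v', hp', h'⟩ : sSup S ∈ S := Nat.sSup_mem ⟨q, p, v, hp, hq⟩ hbdd
  exact hp'.not_isComb hG hgap hxy hconn hcard h'
    fun p v q' h1 h2 => le_csSup hbdd ⟨p, v, h1, h2⟩

end IsIndexedPath

theorem IsLocallyOre.exists_isIndexedPath (hG : G.IsLocallyOre)
    (hxy : ∀ z, G.Adj z x → ¬ G.Adj z y) (hconn : G.Connected) {m : ℕ}
    (hm : G.dist x y + 1 ≤ m) : m ≤ Fintype.card V →
    (∃ p, G.IsIndexedPath x y m p) ∨ ∃ p, G.IsIndexedPath x y (m - 1) p := by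
  induction m, hm using Nat.le_induction with
  | base =>
    intro _
    obtain ⟨w, hw, hlen⟩ := hconn.exists_path_of_dist x y
    exact .inl ⟨_, hlen ▸ hw.isIndexedPath⟩
  | succ m hm ih =>
    intro hcard
    rcases ih (by omega) with h | ⟨p, hp⟩
    · exact .inr h
    -- Here `k = m - 1`, so the two lengths of a gap are `m` and `m + 1`.
    · have h := hp.not_isGap hG hxy hconn (by omega)
      by_contra! hne
      refine h ⟨fun f hf => hne.2 f ?_, fun f hf => hne.1 f ?_⟩
      · convert hf using 1
        omega
      · convert hf using 1
        omega

end Extension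

end SimpleGraph

theorem corollary8 {V : Type*} [Fintype V] [DecidableEq V]
    (G : SimpleGraph V) [DecidableRel G.Adj]
    (hcard : 3 ≤ Fintype.card V)
    (hconn : G.Connected)
    (hL : G.IsLGraph 1)
    (hcommon : ∀ u v : V, G.dist u v = 2 →
      2 ≤ (G.neighborFinset u ∩ G.neighborFinset v).card)
    (x y : V) (hxy : G.neighborFinset x ∩ G.neighborFinset y = ∅)
    (m : ℕ) (hm : G.dist x y + 1 ≤ m) (hm' : m ≤ Fintype.card V) :
    ∃ p : G.Walk x y, p.IsPath ∧ (p.support.length = m ∨ p.support.length + 1 = m) := by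
  have hdisj : ∀ z, G.Adj z x → ¬ G.Adj z y := by
    intro z h1 h2
    have : z ∈ G.neighborFinset x ∩ G.neighborFinset y := by simp [h1.symm, h2.symm]
    simp [hxy] at this
  rcases (hL.isLocallyOre hcommon).exists_isIndexedPath hdisj hconn hm hm' with
    ⟨p, hp⟩ | ⟨p, hp⟩
  · obtain ⟨k, rfl⟩ : ∃ k, m = k + 1 := ⟨m - 1, by omega⟩
    obtain ⟨w, hw, hs⟩ := hp.exists_walk
    exact ⟨w, hw, .inl (by simp [hs])⟩
  · obtain ⟨k, rfl⟩ : ∃ k, m = k + 2 := ⟨m - 2, by have := hp.pos; omega⟩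
    obtain ⟨w, hw, hs⟩ := SimpleGraph.IsIndexedPath.exists_walk (k := k) hp
    exact ⟨w, hw, .inr (by simp [hs])⟩
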